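/- **Aztec diamond theorem.** Let $n\ge 0$ be an integer. The Aztec diamond of order $n$, denoted $\mathrm{Az}(n)\subset\mathbb{R}^2$, is the union of all closed unit squares $[i,i+1]\times[j,j+1]$ ($i,j\in\mathbb{Z}$) all four of whose corners $(x,y)$ satisfy $|x|+|y|\le n+1$. A domino is a closed $1\times 2$ or $2\times 1$ axis-parallel rectangle with integer corners, and a domino tiling of a region $R\subseteq\mathbb{R}^2$ is a set of dominos with pairwise disjoint interiors whose union is $R$. Then the number of domino tilings of $\mathrm{Az}(n)$ is $2^{n(n+1)/2}$. -/

import Mathlib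

namespace Aztec

/-- The closed unit square of the plane whose lower left corner is the lattice point `(i, j)`. -/
def unitSquare (i j : ℤ) : Set (ℝ × ℝ) :=
  Set.Icc (i : ℝ) (i + 1) ×ˢ Set.Icc (j : ℝ) (j + 1)

/-- The Aztec diamond of order `n`: the union of all the unit squares with integral corners
such that each of the four corners `(x, y)` satisfies `|x| + |y| ≤ n + 1`. -/
def aztecDiamond (n : ℕ) : Set (ℝ × ℝ) :=
  ⋃₀ {S | ∃ i j : ℤ, S = unitSquare i j ∧
    ∀ x ∈ ({i, i + 1} : Set ℤ), ∀ y ∈ ({j, j + 1} : Set ℤ), |x| + |y| ≤ (n : ℤ) + 1}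

/-- A domino: a closed 2-by-1 or 1-by-2 rectangle with integral corners. -/
def IsDomino (D : Set (ℝ × ℝ)) : Prop :=
  ∃ i j : ℤ,
    D = Set.Icc (i : ℝ) (i + 2) ×ˢ Set.Icc (j : ℝ) (j + 1) ∨
    D = Set.Icc (i : ℝ) (i + 1) ×ˢ Set.Icc (j : ℝ) (j + 2)

/-- A domino tiling of a region `R`: a set of dominos, no two of which overlap (have a common
interior point), the union of which is `R`. -/
def IsDominoTiling (R : Set (ℝ × ℝ)) (T : Set (Set (ℝ × ℝ))) : Prop :=
  (∀ D ∈ T, IsDomino D) ∧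
  T.Pairwise (fun D E => Disjoint (interior D) (interior E)) ∧
  ⋃₀ T = R

end Aztec

/-!
Every domino in the Aztec diamond of order `n` or `n + 1` is a side, that is, a pair of adjacent
cells, of exactly one of the `(n + 1) ^ 2` two-by-two blocks
centred at the points `(x, y)` with `|x| + |y| ≤ n` and `x + y ≡ n` modulo 2. A tiling thus amounts
to a splitting of the cells among the blocks together with a tiling of each share `S` of a block `K`
by sides of `K`. The blocks cover every cell of the diamond of order `n + 1` once, and those of the
diamond of order `n` once more, so that `S ↦ K \ S` in each block exchanges the splittings of the
two diamonds. If `w S` is the number of tilings of `S`, then `2 * w S = 2 ^ e * w (K \ S)`, where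
`e` is the number of cells of `S` in one chessboard colour. The diamond of order `n + 1` has
`(n + 2) * (n + 1)` cells of that colour, so multiplying over the blocks and summing over the
splittings gives `T (n + 1) = 2 ^ ((n + 2) * (n + 1) - (n + 1) ^ 2) * T n = 2 ^ (n + 1) * T n` for
the numbers `T n` of tilings.
-/

namespace Aztec

open Finset

section DisjointFamilies

variable {ι α : Type*} [Fintype ι] [DecidableEq α] {E : ι → Finset α}

theorem biUnion_inter_eq_of_subset {P : Finset α} (hP : P ⊆ univ.biUnion E) :
    univ.biUnion (fun i => P ∩ E i) = P := by
  rw [← inter_biUnion, inter_eq_left.2 hP]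

theorem biUnion_inter_eq_of_pairwise_disjoint (hE : Pairwise (Function.onFun Disjoint E))
    {Q : ι → Finset α} (hQ : ∀ i, Q i ⊆ E i) (i : ι) : univ.biUnion Q ∩ E i = Q i := by
  ext x
  simp only [mem_inter, mem_biUnion, mem_univ, true_and]
  refine ⟨fun ⟨⟨j, hj⟩, hi⟩ => ?_, fun hx => ⟨⟨i, hx⟩, hQ i hx⟩⟩
  obtain rfl : j = i := by
    by_contra hji
    exact disjoint_left.1 (hE hji) (hQ j hj) hi
  exact hj

theorem sum_biUnion_of_subset_of_pairwise_disjoint {M : Type*} [AddCommMonoid M]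
    (hE : Pairwise (Function.onFun Disjoint E)) {Q : ι → Finset α} (hQ : ∀ i, Q i ⊆ E i)
    (f : α → M) : ∑ x ∈ univ.biUnion Q, f x = ∑ i, ∑ x ∈ Q i, f x :=
  sum_biUnion fun _ _ _ _ hij => (hE hij).mono (hQ _) (hQ _)

end DisjointFamilies

section Tilings

variable {V : Type*} [DecidableEq V]

/-- The tilings of `R` by tiles from `E`. The condition says that the tiles add up to `R` as
multisets, which encodes at once that they are disjoint and that their union is `R`. -/
def tilings (E : Finset (Finset V)) (R : Finset V) : Finset (Finset (Finset V)) :=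
  {P ∈ E.powerset | ∑ D ∈ P, D.val = R.val}

theorem sum_val_eq_iff_pairwiseDisjoint {P : Finset (Finset V)} {R : Finset V} :
    ∑ D ∈ P, D.val = R.val ↔ (P : Set (Finset V)).PairwiseDisjoint id ∧ P.biUnion id = R := by
  have sum_val (hP : (P : Set (Finset V)).PairwiseDisjoint id) :
      ∑ D ∈ P, D.val = (P.biUnion id).val := by
    rw [← disjiUnion_eq_biUnion _ _ hP]
    rfl
  refine ⟨fun h => ?_, fun ⟨hP, hR⟩ => by rw [sum_val hP, hR]⟩
  have hP : (P : Set (Finset V)).PairwiseDisjoint id := by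
    intro D hD D' hD' hne
    have hle : D.val + D'.val ≤ R.val := by
      rw [← h, ← sum_pair (f := fun D : Finset V => D.val) hne]
      exact sum_le_sum_of_subset (by grind)
    exact disjoint_val.1 (Multiset.nodup_add.1 (Multiset.nodup_of_le hle R.nodup)).2.2
  exact ⟨hP, val_injective ((sum_val hP).symm.trans h)⟩

theorem mem_tilings {E P : Finset (Finset V)} {R : Finset V} :
    P ∈ tilings E R ↔
      P ⊆ E ∧ (P : Set (Finset V)).PairwiseDisjoint id ∧ P.biUnion id = R := by
  rw [tilings, mem_filter, mem_powerset, sum_val_eq_iff_pairwiseDisjoint]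

theorem sum_val_of_mem_tilings {E P : Finset (Finset V)} {R : Finset V} (hP : P ∈ tilings E R) :
    ∑ D ∈ P, D.val = R.val :=
  (mem_filter.1 hP).2

theorem card_tilings_map {W : Type*} [DecidableEq W] (f : V ↪ W) (E : Finset (Finset V))
    (R : Finset V) :
    #(tilings (E.map (mapEmbedding f).toEmbedding) (R.map f)) = #(tilings E R) := by
  have sum_map (P : Finset (Finset V)) :
      ∑ D ∈ P.map (mapEmbedding f).toEmbedding, D.val = (∑ D ∈ P, D.val).map f := by
    rw [Finset.sum_map, ← Multiset.coe_mapAddMonoidHom, map_sum]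
    rfl
  rw [← card_map (mapEmbedding (mapEmbedding f).toEmbedding).toEmbedding]
  congr 1
  ext P
  simp only [tilings, mem_filter, mem_powerset, mem_map, subset_map_iff]
  constructor
  · rintro ⟨⟨P, hP, rfl⟩, hR⟩
    rw [sum_map, map_val] at hR
    exact ⟨P, ⟨hP, Multiset.map_injective f.injective hR⟩, rfl⟩
  · rintro ⟨P, ⟨hP, hR⟩, rfl⟩
    exact ⟨⟨P, hP, rfl⟩, (sum_map P).trans (by rw [hR, map_val])⟩

variable {ι : Type*} [Fintype ι] [DecidableEq ι]

/-- The ways to split `R` into disjoint subsets of the sets `K i`, again encoded by an equation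
between multisets. -/
def splittings (K : ι → Finset V) (R : Finset V) : Finset (ι → Finset V) :=
  {S ∈ Fintype.piFinset fun i => (K i).powerset | ∑ i, (S i).val = R.val}

theorem mem_splittings {K S : ι → Finset V} {R : Finset V} :
    S ∈ splittings K R ↔ (∀ i, S i ⊆ K i) ∧ ∑ i, (S i).val = R.val := by
  simp only [splittings, mem_filter, Fintype.mem_piFinset, mem_powerset]

theorem inter_mem_tilings {E E' P : Finset (Finset V)} {R : Finset V} (hP : P ∈ tilings E R) :
    P ∩ E' ∈ tilings E' ((P ∩ E').biUnion id) :=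
  mem_tilings.2
    ⟨inter_subset_right, (mem_tilings.1 hP).2.1.subset (mod_cast inter_subset_left), rfl⟩

theorem biUnion_inter_mem_splittings {E : ι → Finset (Finset V)} {K : ι → Finset V}
    (hE : Pairwise (Function.onFun Disjoint E)) (hK : ∀ i, ∀ D ∈ E i, D ⊆ K i)
    {P : Finset (Finset V)} {R : Finset V} (hP : P ∈ tilings (univ.biUnion E) R) :
    (fun i => (P ∩ E i).biUnion id) ∈ splittings K R := by
  refine mem_splittings.2 ⟨fun i => biUnion_subset.2 fun D hD => hK i D (mem_inter.1 hD).2, ?_⟩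
  calc ∑ i, ((P ∩ E i).biUnion id).val = ∑ i, ∑ D ∈ P ∩ E i, D.val :=
        sum_congr rfl fun i _ => (sum_val_of_mem_tilings (inter_mem_tilings hP)).symm
    _ = ∑ D ∈ P, D.val := by
        rw [← sum_biUnion_of_subset_of_pairwise_disjoint hE fun i => inter_subset_right,
          biUnion_inter_eq_of_subset (mem_tilings.1 hP).1]
    _ = R.val := sum_val_of_mem_tilings hP

theorem biUnion_mem_tilings {E Q : ι → Finset (Finset V)} {K S : ι → Finset V}
    (hE : Pairwise (Function.onFun Disjoint E)) {R : Finset V} (hS : S ∈ splittings K R)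
    (hQ : ∀ i, Q i ∈ tilings (E i) (S i)) : univ.biUnion Q ∈ tilings (univ.biUnion E) R := by
  have hQE (i : ι) : Q i ⊆ E i := (mem_tilings.1 (hQ i)).1
  refine mem_filter.2 ⟨mem_powerset.2 (biUnion_mono fun i _ => hQE i), ?_⟩
  rw [sum_biUnion_of_subset_of_pairwise_disjoint hE hQE,
    sum_congr rfl fun i _ => sum_val_of_mem_tilings (hQ i), (mem_splittings.1 hS).2]

theorem card_tilings_biUnion {E : ι → Finset (Finset V)} {K : ι → Finset V}
    (hE : Pairwise (Function.onFun Disjoint E)) (hK : ∀ i, ∀ D ∈ E i, D ⊆ K i) (R : Finset V) :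
    #(tilings (univ.biUnion E) R) = ∑ S ∈ splittings K R, ∏ i, #(tilings (E i) (S i)) := by
  rw [card_eq_sum_card_fiberwise fun P hP => biUnion_inter_mem_splittings hE hK hP]
  refine sum_congr rfl fun S hS => ?_
  rw [← Fintype.card_piFinset]
  refine card_nbij' (fun P i => P ∩ E i) (fun Q => univ.biUnion Q) ?_ ?_ ?_ ?_
  · intro P hP
    obtain ⟨hPR, rfl⟩ := mem_filter.1 hP
    exact Fintype.mem_piFinset.2 fun i => inter_mem_tilings hPR
  · intro Q hQ
    replace hQ := Fintype.mem_piFinset.1 hQ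
    refine mem_filter.2 ⟨biUnion_mem_tilings hE hS hQ, funext fun i => ?_⟩
    rw [biUnion_inter_eq_of_pairwise_disjoint hE fun i => (mem_tilings.1 (hQ i)).1]
    exact (mem_tilings.1 (hQ i)).2.2
  · intro P hP
    exact biUnion_inter_eq_of_subset (mem_tilings.1 (mem_filter.1 hP).1).1
  · intro Q hQ
    exact funext <| biUnion_inter_eq_of_pairwise_disjoint hE fun i =>
      (mem_tilings.1 (Fintype.mem_piFinset.1 hQ i)).1

theorem sdiff_mem_splittings {K S : ι → Finset V} {R R' : Finset V}
    (hK : ∑ i, (K i).val = R.val + R'.val) (hS : S ∈ splittings K R) :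
    (fun i => K i \ S i) ∈ splittings K R' := by
  obtain ⟨hSK, hSR⟩ := mem_splittings.1 hS
  refine mem_splittings.2 ⟨fun i => sdiff_subset, add_left_cancel (a := R.val) ?_⟩
  rw [← hK, ← hSR, ← sum_add_distrib]
  refine sum_congr rfl fun i _ => ?_
  rw [sdiff_val, add_tsub_cancel_of_le (val_le_iff.2 (hSK i))]

theorem sum_card_filter_of_mem_splittings {K S : ι → Finset V} {R : Finset V}
    (hS : S ∈ splittings K R) (p : V → Prop) [DecidablePred p] :
    ∑ i, #{v ∈ S i | p v} = #{v ∈ R | p v} := by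
  have card_filter (A : Finset V) : #{v ∈ A | p v} = Multiset.countPAddMonoidHom p A.val :=
    (Multiset.countP_eq_card_filter p A.val).symm
  simp only [card_filter, ← map_sum, (mem_splittings.1 hS).2]

end Tilings

section FourCycles

variable {V : Type*} [DecidableEq V]

/-- The edges, as two-element sets, of the four-cycle through `c 0`, `c 1`, `c 2` and `c 3`;
the addition in `Fin 4` is cyclic. -/
def cycleEdges (c : Fin 4 ↪ V) : Finset (Finset V) :=
  univ.image fun k => {c k, c (k + 1)}

theorem subset_of_mem_cycleEdges {c : Fin 4 ↪ V} {D : Finset V} (hD : D ∈ cycleEdges c) :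
    D ⊆ univ.map c := by
  obtain ⟨k, -, rfl⟩ := mem_image.1 hD
  simp [insert_subset_iff]

theorem cycleEdges_eq_map (c : Fin 4 ↪ V) :
    cycleEdges c = (cycleEdges (.refl (Fin 4))).map (mapEmbedding c).toEmbedding := by
  rw [cycleEdges, cycleEdges, map_eq_image, image_image]
  exact image_congr fun k _ => by simp [map_insert]

theorem two_mul_card_tilings_fin_four (S : Finset (Fin 4)) :
    2 * #(tilings (cycleEdges (.refl (Fin 4))) S) =
      2 ^ #{k ∈ S | Even k.val} * #(tilings (cycleEdges (.refl (Fin 4))) (univ \ S)) := by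
  -- The empty set, an edge and the whole cycle have 1, 1 and 2 tilings, other sets none.
  revert S
  decide +kernel

theorem two_mul_card_tilings_cycleEdges {c : Fin 4 ↪ V} {p : V → Prop} [DecidablePred p]
    (hp : ∀ k, p (c k) ↔ Even k.val) {S : Finset V} (hS : S ⊆ univ.map c) :
    2 * #(tilings (cycleEdges c) S) =
      2 ^ #{v ∈ S | p v} * #(tilings (cycleEdges c) (univ.map c \ S)) := by
  obtain ⟨S, -, rfl⟩ := subset_map_iff.1 hS
  have card_filter : #{v ∈ S.map c | p v} = #{k ∈ S | Even k.val} := by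
    simp only [filter_map, card_map, Function.comp_def, hp]
  rw [cycleEdges_eq_map, card_tilings_map, ← Finset.map_sdiff, card_tilings_map, card_filter,
    two_mul_card_tilings_fin_four]

theorem two_pow_mul_card_tilings_eq_of_complement {ι : Type*} [Fintype ι]
    {c : ι → Fin 4 ↪ V} {p : V → Prop} [DecidablePred p] {R R' : Finset V}
    (hc : Pairwise (Function.onFun Disjoint fun i => cycleEdges (c i)))
    (hp : ∀ i k, p (c i k) ↔ Even k.val)
    (hR : ∑ i, (univ.map (c i)).val = R.val + R'.val) :
    2 ^ Fintype.card ι * #(tilings (univ.biUnion fun i => cycleEdges (c i)) R) =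
      2 ^ #{v ∈ R | p v} * #(tilings (univ.biUnion fun i => cycleEdges (c i)) R') := by
  classical
  have hK (i : ι) (D) (hD : D ∈ cycleEdges (c i)) := subset_of_mem_cycleEdges hD
  rw [card_tilings_biUnion hc hK, card_tilings_biUnion hc hK, mul_sum, mul_sum]
  have sdiff_sdiff {R : Finset V} {S : ι → Finset V}
      (hS : S ∈ splittings (fun i => univ.map (c i)) R) :
      (fun i => univ.map (c i) \ (univ.map (c i) \ S i)) = S :=
    funext fun i => Finset.sdiff_sdiff_eq_self ((mem_splittings.1 hS).1 i)
  refine sum_nbij' (fun S i => univ.map (c i) \ S i) (fun S i => univ.map (c i) \ S i)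
    (fun S => sdiff_mem_splittings hR) (fun S => sdiff_mem_splittings (hR.trans (add_comm _ _)))
    (fun S => sdiff_sdiff) (fun S => sdiff_sdiff) fun S hS => ?_
  calc 2 ^ Fintype.card ι * ∏ i, #(tilings (cycleEdges (c i)) (S i))
      = ∏ i, 2 * #(tilings (cycleEdges (c i)) (S i)) := by
        rw [prod_mul_distrib, prod_const, card_univ]
    _ = ∏ i, 2 ^ #{v ∈ S i | p v} * #(tilings (cycleEdges (c i)) (univ.map (c i) \ S i)) :=
        prod_congr rfl fun i _ =>
          two_mul_card_tilings_cycleEdges (hp i) ((mem_splittings.1 hS).1 i)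
    _ = 2 ^ #{v ∈ R | p v} * ∏ i, #(tilings (cycleEdges (c i)) (univ.map (c i) \ S i)) := by
        rw [prod_mul_distrib, prod_pow_eq_pow_sum, sum_card_filter_of_mem_splittings hS]

end FourCycles

section Regions

/-- The region of the plane made up of a set of cells, the cell `(x, y)` being the closed unit
square with lower left corner `(x, y)`. -/
def region (C : Set (ℤ × ℤ)) : Set (ℝ × ℝ) := ⋃ c ∈ C, unitSquare c.1 c.2

theorem region_biUnion {α : Type*} (s : Set α) (C : α → Set (ℤ × ℤ)) :
    region (⋃ a ∈ s, C a) = ⋃ a ∈ s, region (C a) := by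
  simp only [region, Set.biUnion_iUnion]

theorem mem_Icc_intCast_iff_floor_eq {x : ℝ} (hx : x ∉ Set.range ((↑) : ℤ → ℝ)) {i : ℤ} :
    x ∈ Set.Icc (i : ℝ) (i + 1) ↔ ⌊x⌋ = i := by
  have hne : x ≠ i + 1 := fun h => hx ⟨i + 1, by rw [h]; push_cast; rfl⟩
  rw [Int.floor_eq_iff, Set.mem_Icc, hne.le_iff_lt]

/-- The points with no integral coordinate. Each of them lies in exactly one unit square, so that
a set of cells can be recovered from the generic points of its region. -/
def genericPoints : Set (ℝ × ℝ) :=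
  (Set.range ((↑) : ℤ → ℝ))ᶜ ×ˢ (Set.range ((↑) : ℤ → ℝ))ᶜ

theorem dense_genericPoints : Dense genericPoints :=
  have hdense : Dense (Set.range ((↑) : ℤ → ℝ))ᶜ := (Set.countable_range _).dense_compl ℝ
  hdense.prod hdense

theorem mem_region_iff_floor_mem {p : ℝ × ℝ} (hp : p ∈ genericPoints) {C : Set (ℤ × ℤ)} :
    p ∈ region C ↔ (⌊p.1⌋, ⌊p.2⌋) ∈ C := by
  simp only [region, unitSquare, Set.mem_iUnion₂, Set.mem_prod, mem_Icc_intCast_iff_floor_eq hp.1,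
    mem_Icc_intCast_iff_floor_eq hp.2]
  exact ⟨fun ⟨_, hc, hx, hy⟩ => hx ▸ hy ▸ hc, fun h => ⟨_, h, rfl, rfl⟩⟩

theorem exists_genericPoint_mem_interior_unitSquare (c : ℤ × ℤ) :
    ∃ p ∈ genericPoints, p ∈ interior (unitSquare c.1 c.2) ∧ (⌊p.1⌋, ⌊p.2⌋) = c := by
  have hne : (interior (unitSquare c.1 c.2)).Nonempty := by
    rw [unitSquare, interior_prod_eq, interior_Icc, interior_Icc]
    exact (Set.nonempty_Ioo.2 (lt_add_one _)).prod (Set.nonempty_Ioo.2 (lt_add_one _))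
  obtain ⟨p, hp, hgen⟩ := dense_genericPoints.inter_open_nonempty _ isOpen_interior hne
  obtain ⟨hx, hy⟩ := interior_subset hp
  exact ⟨p, hgen, hp, Prod.ext ((mem_Icc_intCast_iff_floor_eq hgen.1).1 hx)
    ((mem_Icc_intCast_iff_floor_eq hgen.2).1 hy)⟩

theorem region_subset_region_iff {A B : Set (ℤ × ℤ)} : region A ⊆ region B ↔ A ⊆ B := by
  refine ⟨fun h c hc => ?_, fun h => Set.biUnion_subset_biUnion_left h⟩
  obtain ⟨p, hgen, -, rfl⟩ := exists_genericPoint_mem_interior_unitSquare c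
  exact (mem_region_iff_floor_mem hgen).1 (h ((mem_region_iff_floor_mem hgen).2 hc))

theorem region_injective : Function.Injective region := fun _ _ h =>
  (region_subset_region_iff.1 h.le).antisymm (region_subset_region_iff.1 h.ge)

theorem disjoint_interior_region_iff {A B : Set (ℤ × ℤ)} :
    Disjoint (interior (region A)) (interior (region B)) ↔ Disjoint A B := by
  refine ⟨fun h => Set.disjoint_left.2 fun c hA hB => ?_, fun h => ?_⟩
  · obtain ⟨p, -, hp, -⟩ := exists_genericPoint_mem_interior_unitSquare c
    exact Set.disjoint_left.1 h (interior_mono (Set.subset_biUnion_of_mem hA) hp)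
      (interior_mono (Set.subset_biUnion_of_mem hB) hp)
  · by_contra hAB
    obtain ⟨p, ⟨hA, hB⟩, hgen⟩ := dense_genericPoints.inter_open_nonempty _
      (isOpen_interior.inter isOpen_interior) (Set.not_disjoint_iff_nonempty_inter.1 hAB)
    exact Set.disjoint_left.1 h ((mem_region_iff_floor_mem hgen).1 (interior_subset hA))
      ((mem_region_iff_floor_mem hgen).1 (interior_subset hB))

/-- The pairs of cells that share a side, that is, dominoes as sets of cells. -/
def IsCellDomino (D : Finset (ℤ × ℤ)) : Prop :=
  ∃ x y : ℤ, D = {(x, y), (x + 1, y)} ∨ D = {(x, y), (x, y + 1)}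

theorem Icc_union_Icc_add_one_add_two (i : ℤ) :
    Set.Icc (i : ℝ) (i + 1) ∪ Set.Icc ((i + 1 : ℤ) : ℝ) ((i + 1 : ℤ) + 1) =
      Set.Icc (i : ℝ) (i + 2) := by
  push_cast
  rw [Set.Icc_union_Icc_eq_Icc (by linarith) (by linarith), add_assoc, one_add_one_eq_two]

theorem region_horizontal (x y : ℤ) :
    region {(x, y), (x + 1, y)} = Set.Icc (x : ℝ) (x + 2) ×ˢ Set.Icc (y : ℝ) (y + 1) := by
  rw [region, Set.biUnion_pair, unitSquare, unitSquare, ← Set.union_prod,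
    Icc_union_Icc_add_one_add_two]

theorem region_vertical (x y : ℤ) :
    region {(x, y), (x, y + 1)} = Set.Icc (x : ℝ) (x + 1) ×ˢ Set.Icc (y : ℝ) (y + 2) := by
  rw [region, Set.biUnion_pair, unitSquare, unitSquare, ← Set.prod_union,
    Icc_union_Icc_add_one_add_two]

theorem region_coe_injective :
    Function.Injective fun D : Finset (ℤ × ℤ) => region (D : Set (ℤ × ℤ)) :=
  region_injective.comp coe_injective

theorem isDomino_iff_exists_isCellDomino {D : Set (ℝ × ℝ)} :
    IsDomino D ↔ ∃ d : Finset (ℤ × ℤ), IsCellDomino d ∧ region d = D := by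
  constructor
  · rintro ⟨x, y, rfl | rfl⟩
    · exact ⟨{(x, y), (x + 1, y)}, ⟨x, y, .inl rfl⟩, by push_cast; exact region_horizontal x y⟩
    · exact ⟨{(x, y), (x, y + 1)}, ⟨x, y, .inr rfl⟩, by push_cast; exact region_vertical x y⟩
  · rintro ⟨_, ⟨x, y, rfl | rfl⟩, rfl⟩
    · exact ⟨x, y, .inl (by push_cast; exact region_horizontal x y)⟩
    · exact ⟨x, y, .inr (by push_cast; exact region_vertical x y)⟩

theorem isDomino_region_iff {D : Finset (ℤ × ℤ)} :
    IsDomino (region D) ↔ IsCellDomino D := by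
  rw [isDomino_iff_exists_isCellDomino]
  exact ⟨fun ⟨_, hd, h⟩ => region_coe_injective h ▸ hd, fun h => ⟨D, h, rfl⟩⟩

theorem isDominoTiling_region_image_iff {R : Finset (ℤ × ℤ)} {P : Finset (Finset (ℤ × ℤ))} :
    IsDominoTiling (region R) ((fun D : Finset (ℤ × ℤ) => region D) '' P) ↔
      (∀ D ∈ P, IsCellDomino D) ∧ (P : Set (Finset (ℤ × ℤ))).PairwiseDisjoint id ∧
        P.biUnion id = R := by
  refine and_congr ?_ (and_congr ?_ ?_)
  · simp only [Set.forall_mem_image, isDomino_region_iff, mem_coe]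
  · rw [region_coe_injective.injOn.pairwise_image]
    refine forall₅_congr fun D _ D' _ _ => ?_
    exact disjoint_interior_region_iff.trans disjoint_coe
  · rw [Set.sUnion_image, ← region_biUnion, region_injective.eq_iff, ← coe_inj, coe_biUnion]
    rfl

theorem IsDominoTiling.exists_image_region_eq {R : Finset (ℤ × ℤ)} {T : Set (Set (ℝ × ℝ))}
    (hT : IsDominoTiling (region R) T) :
    ∃ P : Finset (Finset (ℤ × ℤ)), (fun D : Finset (ℤ × ℤ) => region D) '' P = T := by
  classical
  refine ⟨{D ∈ R.powerset | region D ∈ T}, Set.Subset.antisymm ?_ fun D hD => ?_⟩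
  · rintro _ ⟨D, hD, rfl⟩
    exact (mem_filter.1 hD).2
  · obtain ⟨d, -, rfl⟩ := isDomino_iff_exists_isCellDomino.1 (hT.1 D hD)
    have hdR : region d ⊆ region R := hT.2.2 ▸ Set.subset_sUnion_of_mem hD
    exact ⟨d, mem_filter.2 ⟨mem_powerset.2 (region_subset_region_iff.1 hdR), hD⟩, rfl⟩

theorem ncard_isDominoTiling_region {R : Finset (ℤ × ℤ)} {E : Finset (Finset (ℤ × ℤ))}
    (hE : ∀ D ⊆ R, D ∈ E ↔ IsCellDomino D) :
    {T | IsDominoTiling (region R) T}.ncard = #(tilings E R) := by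
  have himage : {T | IsDominoTiling (region R) T} =
      (fun P : Finset (Finset (ℤ × ℤ)) => (fun D : Finset (ℤ × ℤ) => region D) '' P) ''
        tilings E R := by
    have mem_iff (P : Finset (Finset (ℤ × ℤ))) : P ∈ tilings E R ↔
        IsDominoTiling (region R) ((fun D : Finset (ℤ × ℤ) => region D) '' P) := by
      rw [mem_tilings, isDominoTiling_region_image_iff]
      refine and_congr_left fun ⟨_, hP⟩ => forall₂_congr fun D hD => hE D ?_
      exact hP ▸ subset_biUnion_of_mem id hD
    ext T
    constructor
    · intro hT
      obtain ⟨P, rfl⟩ := IsDominoTiling.exists_image_region_eq hT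
      exact ⟨P, (mem_iff P).2 hT, rfl⟩
    · rintro ⟨P, hP, rfl⟩
      exact (mem_iff P).1 hP
  rw [himage, Set.ncard_image_of_injective, Set.ncard_coe_finset]
  exact (Set.image_injective.2 region_coe_injective).comp coe_injective

end Regions

section AztecDiamond

/-- The cells of the Aztec diamond of order `n`. The cell `(x, y)` is centred at
`(x + 1 / 2, y + 1 / 2)`, whence the asymmetric bounds on `x + y`; the box only serves to make the
set finite. -/
noncomputable def aztecCells (n : ℕ) : Finset (ℤ × ℤ) :=
  {v ∈ Icc (-(n : ℤ) - 1) n ×ˢ Icc (-(n : ℤ) - 1) n |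
    -(n : ℤ) - 1 ≤ v.1 + v.2 ∧ v.1 + v.2 ≤ n - 1 ∧ -(n : ℤ) ≤ v.1 - v.2 ∧ v.1 - v.2 ≤ n}

theorem mem_aztecCells {n : ℕ} {x y : ℤ} :
    (x, y) ∈ aztecCells n ↔
      -(n : ℤ) - 1 ≤ x + y ∧ x + y ≤ n - 1 ∧ -(n : ℤ) ≤ x - y ∧ x - y ≤ n := by
  simp only [aztecCells, mem_filter, mem_product, mem_Icc]
  omega

theorem aztecDiamond_eq_region (n : ℕ) : aztecDiamond n = region (aztecCells n) := by
  have mem_iff (x y : ℤ) : (x, y) ∈ aztecCells n ↔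
      ∀ x' ∈ ({x, x + 1} : Set ℤ), ∀ y' ∈ ({y, y + 1} : Set ℤ), |x'| + |y'| ≤ (n : ℤ) + 1 := by
    rw [mem_aztecCells]
    simp only [Set.mem_insert_iff, Set.mem_singleton_iff, forall_eq_or_imp, forall_eq]
    grind
  ext p
  simp only [aztecDiamond, region, Set.mem_sUnion, Set.mem_ofPred_eq, Set.mem_iUnion₂, mem_coe,
    Prod.exists, exists_prop, ← mem_iff]
  exact ⟨fun ⟨_, ⟨x, y, rfl, hc⟩, hp⟩ => ⟨x, y, hc, hp⟩,
    fun ⟨x, y, hc, hp⟩ => ⟨_, ⟨x, y, rfl, hc⟩, hp⟩⟩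

/-- The four cells around the lattice point `p`, counterclockwise from the north-east. -/
def block (p : ℤ × ℤ) : Fin 4 ↪ ℤ × ℤ where
  toFun := ![(p.1, p.2), (p.1 - 1, p.2), (p.1 - 1, p.2 - 1), (p.1, p.2 - 1)]
  inj' := by
    intro k l
    fin_cases k <;> fin_cases l <;> simp [Prod.ext_iff] <;> omega

/-- The points `q + (a - b, a + b)` with `0 ≤ a < k` and `0 ≤ b < l`. -/
def rotatedRectangle (k l : ℕ) (q : ℤ × ℤ) : Finset (ℤ × ℤ) :=
  (range k ×ˢ range l).image fun a => (q.1 + a.1 - a.2, q.2 + a.1 + a.2)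

theorem card_rotatedRectangle (k l : ℕ) (q : ℤ × ℤ) : #(rotatedRectangle k l q) = k * l := by
  rw [rotatedRectangle, card_image_of_injective, card_product, card_range, card_range]
  intro a b h
  simp only [Prod.mk.injEq] at h
  ext <;> omega

theorem mem_rotatedRectangle {k l : ℕ} {q : ℤ × ℤ} {x y : ℤ} :
    (x, y) ∈ rotatedRectangle k l q ↔ Even (x + y + (q.1 + q.2)) ∧
      (q.1 + q.2 ≤ x + y ∧ x + y < q.1 + q.2 + 2 * k) ∧
      (q.2 - q.1 ≤ y - x ∧ y - x < q.2 - q.1 + 2 * l) := by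
  simp only [rotatedRectangle, mem_image, mem_product, mem_range, Prod.exists, Prod.mk.injEq,
    Int.even_iff]
  refine ⟨fun ⟨a, b, _, _, _⟩ => by omega, fun h => ?_⟩
  exact ⟨((x + y - q.1 - q.2) / 2).toNat, ((y - x - q.2 + q.1) / 2).toNat, by omega⟩

/-- The centres of the blocks into which the dominoes of the Aztec diamonds of orders `n` and
`n + 1` are grouped. -/
def blockCentres (n : ℕ) : Finset (ℤ × ℤ) := rotatedRectangle (n + 1) (n + 1) (0, -n)

theorem mem_blockCentres {n : ℕ} {x y : ℤ} :
    (x, y) ∈ blockCentres n ↔ Even (x + y + n) ∧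
      (-(n : ℤ) ≤ x + y ∧ x + y ≤ n) ∧ -(n : ℤ) ≤ x - y ∧ x - y ≤ n := by
  simp only [blockCentres, mem_rotatedRectangle, Int.even_iff]
  omega

theorem cycleEdges_block (x y : ℤ) :
    cycleEdges (block (x, y)) =
      {{(x - 1, y), (x, y)}, {(x - 1, y - 1), (x - 1, y)}, {(x - 1, y - 1), (x, y - 1)},
        {(x, y - 1), (x, y)}} := by
  rw [cycleEdges, show (univ : Finset (Fin 4)) = {0, 1, 2, 3} from rfl,
    pair_comm (x - 1, y) (x, y), pair_comm (x - 1, y - 1) (x - 1, y)]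
  simp only [image_insert, image_singleton]
  rfl

theorem mem_biUnion_cycleEdges_block_iff {n : ℕ} {D : Finset (ℤ × ℤ)}
    (hD : D ⊆ aztecCells (n + 1)) :
    D ∈ univ.biUnion (fun p : blockCentres n => cycleEdges (block p)) ↔ IsCellDomino D := by
  simp only [mem_biUnion, mem_univ, true_and, Subtype.exists, exists_prop, Prod.exists]
  constructor
  · rintro ⟨x, y, -, hxy⟩
    simp only [cycleEdges_block, mem_insert, mem_singleton] at hxy
    rcases hxy with rfl | rfl | rfl | rfl
    · exact ⟨x - 1, y, .inl (by rw [sub_add_cancel])⟩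
    · exact ⟨x - 1, y - 1, .inr (by rw [sub_add_cancel])⟩
    · exact ⟨x - 1, y - 1, .inl (by rw [sub_add_cancel])⟩
    · exact ⟨x, y - 1, .inr (by rw [sub_add_cancel])⟩
  · rintro ⟨x, y, rfl | rfl⟩ <;>
      simp only [insert_subset_iff, singleton_subset_iff, mem_aztecCells] at hD <;>
      rcases Int.even_or_odd (x + y + n) with h | h
    · exact ⟨x + 1, y + 1, mem_blockCentres.2 (by grind), by simp [cycleEdges_block]⟩
    · exact ⟨x + 1, y, mem_blockCentres.2 (by grind), by simp [cycleEdges_block]⟩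
    · exact ⟨x + 1, y + 1, mem_blockCentres.2 (by grind), by simp [cycleEdges_block]⟩
    · exact ⟨x, y + 1, mem_blockCentres.2 (by grind), by simp [cycleEdges_block]⟩

theorem map_block_univ (p : ℤ × ℤ) :
    univ.map (block p) = Icc (p.1 - 1) p.1 ×ˢ Icc (p.2 - 1) p.2 := by
  ext v
  have hv : v ∈ univ.map (block p) ↔ v = (p.1, p.2) ∨ v = (p.1 - 1, p.2) ∨
      v = (p.1 - 1, p.2 - 1) ∨ v = (p.1, p.2 - 1) := by
    simp [block, Fin.exists_fin_succ, eq_comm]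
  rw [hv]
  simp only [mem_product, mem_Icc, Prod.ext_iff]
  omega

theorem eq_of_mem_cycleEdges_block {p q : ℤ × ℤ} {D : Finset (ℤ × ℤ)}
    (hpq : Even (p.1 + p.2 + (q.1 + q.2))) (hp : D ∈ cycleEdges (block p))
    (hq : D ∈ cycleEdges (block q)) : p = q := by
  have hD := subset_of_mem_cycleEdges hq
  simp only [cycleEdges_block p.1 p.2, mem_insert, mem_singleton] at hp
  rw [Int.even_iff] at hpq
  rcases hp with rfl | rfl | rfl | rfl <;>
    simp only [map_block_univ, insert_subset_iff, singleton_subset_iff, mem_product, mem_Icc]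
      at hD <;>
    ext <;> omega

theorem even_block_iff {m : ℤ} {p : ℤ × ℤ} (hp : Even (p.1 + p.2 + m)) (k : Fin 4) :
    Even ((block p k).1 + (block p k).2 + m) ↔ Even k.val := by
  fin_cases k
  · exact iff_of_true hp (by decide)
  · exact iff_of_false (show ¬Even (p.1 - 1 + p.2 + m) by grind) (by decide)
  · exact iff_of_true (show Even (p.1 - 1 + (p.2 - 1) + m) by grind) (by decide)
  · exact iff_of_false (show ¬Even (p.1 + (p.2 - 1) + m) by grind) (by decide)

theorem sum_map_block_val (n : ℕ) :
    ∑ p : blockCentres n, (univ.map (block p)).val =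
      (aztecCells (n + 1)).val + (aztecCells n).val := by
  have count_block (x y : ℤ) (p : ℤ × ℤ) : (univ.map (block p)).val.count (x, y) =
      (if p = (x, y) then 1 else 0) + (if p = (x + 1, y) then 1 else 0) +
        (if p = (x + 1, y + 1) then 1 else 0) + (if p = (x, y + 1) then 1 else 0) := by
    rw [map_block_univ, Multiset.count_eq_of_nodup (nodup _)]
    simp only [mem_val, mem_product, mem_Icc, Prod.ext_iff]
    split_ifs <;> omega
  ext ⟨x, y⟩
  rw [Multiset.count_sum', sum_coe_sort (blockCentres n) fun p => (univ.map (block p)).val.count _]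
  simp only [count_block, Multiset.count_add, sum_add_distrib, mem_val, sum_ite_eq',
    Multiset.count_eq_of_nodup (nodup _), mem_blockCentres, mem_aztecCells, Int.even_iff]
  push_cast
  split_ifs <;> omega

theorem card_even_aztecCells_succ (n : ℕ) :
    #{v ∈ aztecCells (n + 1) | Even (v.1 + v.2 + (n : ℤ))} = (n + 2) * (n + 1) := by
  have h : {v ∈ aztecCells (n + 1) | Even (v.1 + v.2 + (n : ℤ))} =
      rotatedRectangle (n + 2) (n + 1) (-1, -n - 1) := by
    ext ⟨x, y⟩
    simp only [mem_filter, mem_aztecCells, mem_rotatedRectangle, Int.even_iff]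
    omega
  rw [h, card_rotatedRectangle]

theorem pairwise_disjoint_cycleEdges_block (n : ℕ) :
    Pairwise (Function.onFun Disjoint fun p : blockCentres n => cycleEdges (block p)) := by
  refine fun p q hpq => disjoint_left.2 fun D hp hq => hpq (Subtype.ext ?_)
  refine eq_of_mem_cycleEdges_block ?_ hp hq
  have hp := (mem_blockCentres.1 p.2).1
  have hq := (mem_blockCentres.1 q.2).1
  grind

theorem card_tilings_aztecCells_succ (n : ℕ) :
    #(tilings (univ.biUnion fun p : blockCentres n => cycleEdges (block p)) (aztecCells (n + 1))) =
      2 ^ (n + 1) *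
        #(tilings (univ.biUnion fun p : blockCentres n => cycleEdges (block p))
          (aztecCells n)) := by
  have h := two_pow_mul_card_tilings_eq_of_complement (pairwise_disjoint_cycleEdges_block n)
    (p := fun v => Even (v.1 + v.2 + (n : ℤ))) (fun p => even_block_iff (mem_blockCentres.1 p.2).1)
    (sum_map_block_val n)
  rw [Fintype.card_coe, blockCentres, card_rotatedRectangle, card_even_aztecCells_succ,
    show (n + 2) * (n + 1) = (n + 1) * (n + 1) + (n + 1) by ring, pow_add, mul_assoc] at h
  exact Nat.eq_of_mul_eq_mul_left (by positivity) h

theorem ncard_isDominoTiling_aztecDiamond_succ (n : ℕ) :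
    {T | IsDominoTiling (aztecDiamond (n + 1)) T}.ncard =
      2 ^ (n + 1) * {T | IsDominoTiling (aztecDiamond n) T}.ncard := by
  have hsubset : aztecCells n ⊆ aztecCells (n + 1) := by
    rintro ⟨x, y⟩
    simp only [mem_aztecCells]
    omega
  rw [aztecDiamond_eq_region, aztecDiamond_eq_region,
    ncard_isDominoTiling_region fun D hD => mem_biUnion_cycleEdges_block_iff hD,
    ncard_isDominoTiling_region fun D hD => mem_biUnion_cycleEdges_block_iff (hD.trans hsubset),
    card_tilings_aztecCells_succ]

theorem ncard_isDominoTiling_aztecDiamond_zero :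
    {T | IsDominoTiling (aztecDiamond 0) T}.ncard = 1 := by
  have hempty : aztecCells 0 = ∅ := by
    refine eq_empty_of_forall_notMem fun ⟨x, y⟩ h => ?_
    rw [mem_aztecCells] at h
    omega
  rw [aztecDiamond_eq_region, hempty, ncard_isDominoTiling_region (E := ∅)]
  · rfl
  · intro D hD
    obtain rfl := subset_empty.1 hD
    simp [IsCellDomino, eq_comm (a := ∅)]

end AztecDiamond

end Aztec

theorem mainTheorem1 (n : ℕ) :
    {T : Set (Set (ℝ × ℝ)) | Aztec.IsDominoTiling (Aztec.aztecDiamond n) T}.ncard =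
      2 ^ (n * (n + 1) / 2) := by
  induction n with
  | zero => exact Aztec.ncard_isDominoTiling_aztecDiamond_zero
  | succ n ih =>
    rw [Aztec.ncard_isDominoTiling_aztecDiamond_succ, ih, ← pow_add,
      show (n + 1) * (n + 1 + 1) = n * (n + 1) + (n + 1) * 2 by ring,
      Nat.add_mul_div_right _ _ two_pos, add_comm]
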